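/- **Setting.** Let $(M,\omega)$ be a symplectic manifold with a smooth proper action of a Lie group $G$ by symplectomorphisms and an equivariant momentum map $J:M\to\mathfrak g^*$, $d\langle J,\xi\rangle=\iota_{\xi_M}\omega$. Let $\mu\in\mathfrak g^*$, $J_\mu=J^{-1}(\mu)$, let $G_\mu$ be the coadjoint isotropy group of $\mu$, and let $\pi_\mu:J_\mu\to M_\mu=J_\mu/G_\mu$ be the quotient map. Fix $x_0\in J_\mu$ and let $\mathcal S\subset M_\mu$ be the symplectic stratum through $[x_0]$, that is, the connected component of $[x_0]$ in the set of orbits of points of $J_\mu$ whose stabilizer is conjugate to $G_{x_0}$. It carries the smooth structure for which $\pi_\mu:\pi_\mu^{-1}(\mathcal S)\to\mathcal S$ is a submersion ($\pi_\mu^{-1}(\mathcal S)$ being an embedded submanifold of $M$) and the reduced symplectic form $\omega_{\mathcal S}$, determined by the condition that $\pi_\mu^*\omega_{\mathcal S}$ is the restriction of $\omega$ to $\pi_\mu^{-1}(\mathcal S)$. Let $2n=\dim\mathcal S$. Let $N\subset M$ be an embedded symplectic submanifold with $x_0\in N\subset\pi_\mu^{-1}(\mathcal S)$ such that $\pi:=\pi_\mu|_N:N\to\mathcal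 S$ is a diffeomorphism onto an open set $U_{\mathcal S}\subset\mathcal S$ (a symplectic slice). Let $H_\varepsilon=H_0+\varepsilon H_1$, $|\varepsilon|<\varepsilon_0$ with $\varepsilon_0>0$, where $H_0$ and $H_1$ are smooth $G$-invariant functions on $M$ ($H_1$ may depend on $\varepsilon$). For a $G$-invariant function $F$ on $M$ let $\widetilde F$ be the induced function on $\mathcal S$, $\widetilde F([x])=F(x)$; so $\widetilde H_\varepsilon=\widetilde H_0+\varepsilon\widetilde H_1$. The Poisson bracket of a symplectic form $\omega$ is $\{f,g\}=X_f[g]$ with $\iota_{X_f}\omega=-df$. Assume that for all $|\varepsilon|<\varepsilon_0$ and all $f\in C^\infty(U_{\mathcal S})$, $$\{H_\varepsilon|_N,\,f\circ\pi\}_N=\{\widetilde H_\varepsilon,\,f\}_{\mathcal S}\circ\pi .$$ **Definitions.** On a $2n$-dimensional symplectic manifold, a smooth function is *Liouville integrable* on an open set $V$ if it has $n$ smooth first integrals on $V$ which are in involution and whose differentials are linearly independent on a dense subset of $V$. *Action-angle coordinates* on an open set $W$ are a diffeomorphism $(\theta,I):W\to\mathbb T^n\times D$, with $D\subset\mathbb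 R^n$ open, in which the symplectic form is $\sum_i dI_i\wedge d\theta_i$; they are action-angle coordinates *for* $H_0$ if moreover $H_0=h_0(I)$ with $h_0$ smooth on $D$. The family $H_\varepsilon=H_0+\varepsilon H_1$ is *near-integrable* on an open set $V$ if $H_0$ is Liouville integrable on $V$ and on some nonempty open $W\subset V$ there are action-angle coordinates $(\theta,I)$ in which, for all $|\varepsilon|<\varepsilon_0$, $$H_\varepsilon=h_0(I)+\varepsilon\,h_1(\theta,I;\varepsilon),$$ with $h_0$ smooth on $D$ and $h_1(\cdot,\cdot;\varepsilon)$ smooth on $\mathbb T^n\times D$. **Statement.** 1. $H_\varepsilon|_N$ is near-integrable on $N$ (with the symplectic form $\omega|_N$) if and only if $\widetilde H_\varepsilon$ is near-integrable on $U_{\mathcal S}$ (with $\omega_{\mathcal S}$). 2. For every $W\subset U_{\mathcal S}$, $(\theta,I)$ are action-angle coordinates on $W$ for $\widetilde H_0$, with $\widetilde H_0=h_0(I)$, if and only if $(\theta\circ\pi,I\circ\pi)$ are action-angle coordinates on $\pi^{-1}(W)$ for $H_0|_N$, with $H_0|_N=h_0(I\circ\pi)$. 3. The perturbation terms correspond under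 composition with $\pi$: $H_1|_N=\widetilde H_1\circ\pi$, and $\widetilde H_\varepsilon=h_0(I)+\varepsilon h_1(\theta,I;\varepsilon)$ on $W\subset U_{\mathcal S}$ for all $|\varepsilon|<\varepsilon_0$ if and only if $H_\varepsilon|_N=h_0(I\circ\pi)+\varepsilon h_1(\theta\circ\pi,I\circ\pi;\varepsilon)$ on $\pi^{-1}(W)$ for all $|\varepsilon|<\varepsilon_0$, with the same smooth functions $h_0$ and $h_1$. -/

import Mathlib

open scoped Manifold ContDiff

noncomputable section

namespace MomentumSlice

/-! ### Differential two-forms, symplectic forms and Poisson brackets -/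

/-- A (set-theoretic) differential two-form on a manifold `M` of dimension `d`. -/
abbrev TwoForm (d : ℕ) (M : Type*) [TopologicalSpace M]
    [ChartedSpace (EuclideanSpace ℝ (Fin d)) M] : Type _ :=
  ∀ x : M, (TangentSpace (𝓡 d) x) [⋀^Fin 2]→L[ℝ] ℝ

section Forms

variable {d d' : ℕ} {M M' : Type*} [TopologicalSpace M]
  [ChartedSpace (EuclideanSpace ℝ (Fin d)) M] [TopologicalSpace M']
  [ChartedSpace (EuclideanSpace ℝ (Fin d')) M']

/-- The pullback `φ^* Ω` of a two-form. -/
def pullback (φ : M → M') (Ω : TwoForm d' M') : TwoForm d M := fun x =>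
  (Ω (φ x)).compContinuousLinearMap (mfderiv (𝓡 d) (𝓡 d') φ x)

/-- The expression of a two-form in the preferred chart at `p`, a two-form on (an open subset of)
the model space. -/
def formInChart (Ω : TwoForm d M) (p : M) :
    EuclideanSpace ℝ (Fin d) → (EuclideanSpace ℝ (Fin d)) [⋀^Fin 2]→L[ℝ] ℝ := fun y =>
  (Ω ((extChartAt (𝓡 d) p).symm y)).compContinuousLinearMap
    (mfderiv (𝓡 d) (𝓡 d) (extChartAt (𝓡 d) p).symm y)

/-- Nondegeneracy of a two-form at every point. -/
def Nondegenerate (Ω : TwoForm d M) : Prop :=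
  ∀ (x : M) (v : TangentSpace (𝓡 d) x), (∀ w : TangentSpace (𝓡 d) x, Ω x ![v, w] = 0) → v = 0

/-- A symplectic form: a smooth, closed, nondegenerate two-form. -/
structure IsSymplecticForm (Ω : TwoForm d M) : Prop where
  smooth : ∀ p : M, ContDiffOn ℝ ∞ (formInChart Ω p) (extChartAt (𝓡 d) p).target
  closed : ∀ p : M, ∀ y ∈ (extChartAt (𝓡 d) p).target, extDeriv (formInChart Ω p) y = 0
  nondegenerate : Nondegenerate Ω

/-- The differential of a real function, as a covector. -/
def differential (f : M → ℝ) (x : M) : TangentSpace (𝓡 d) x →L[ℝ] ℝ :=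
  mfderiv (𝓡 d) 𝓘(ℝ, ℝ) f x

open Classical in
/-- The Hamiltonian vector field of `f`, defined by `ι_{X_f} Ω = -df`. For a nondegenerate form it
exists and is unique; the default value `0` is used otherwise. -/
def hamiltonianVectorField (Ω : TwoForm d M) (f : M → ℝ) (x : M) : TangentSpace (𝓡 d) x :=
  if h : ∃ v : TangentSpace (𝓡 d) x,
      ∀ w : TangentSpace (𝓡 d) x, Ω x ![v, w] = -differential f x w
  then h.choose else 0

/-- The Poisson bracket `{f, g} = X_f[g]`. -/
def poissonBracket (Ω : TwoForm d M) (f g : M → ℝ) (x : M) : ℝ :=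
  differential g x (hamiltonianVectorField Ω f x)

/-- `φ` is a diffeomorphism of `M` onto the open subset `U` of `M'`. -/
structure IsDiffeomorphOnto (φ : M → M') (U : Set M') : Prop where
  isOpen : IsOpen U
  mapsTo : ∀ x, φ x ∈ U
  smooth : ContMDiff (𝓡 d) (𝓡 d') ∞ φ
  exists_inverse : ∃ σ : M' → M, ContMDiffOn (𝓡 d') (𝓡 d) ∞ σ U ∧
    (∀ x, σ (φ x) = x) ∧ ∀ y ∈ U, φ (σ y) = y

/-- For a circle-valued map `z = e^{iϑ}`, the one-form `dϑ = Im (conj z · dz)`. -/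
def angleDifferential (z : M → Circle) (x : M) (v : TangentSpace (𝓡 d) x) : ℝ :=
  let dz : TangentSpace (𝓡 d) x →L[ℝ] ℂ := mfderiv (𝓡 d) 𝓘(ℝ, ℂ) (fun y => (z y : ℂ)) x
  (star (z x : ℂ) * dz v).im

end Forms

/-! ### Liouville integrability, action-angle coordinates, near-integrability -/

section Integrability

variable {n : ℕ} {M : Type*} [TopologicalSpace M]
  [ChartedSpace (EuclideanSpace ℝ (Fin (2 * n))) M]

/-- `H` is Liouville integrable on the open set `V` of the `2n`-dimensional symplectic manifold
`(M, Ω)`: there are `n` first integrals of `H` on `V` in involution, functionally independent (their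
differentials are linearly independent on a dense subset of `V`). -/
def IsLiouvilleIntegrableOn (Ω : TwoForm (2 * n) M) (H : M → ℝ) (V : Set M) : Prop :=
  ∃ F : Fin n → M → ℝ,
    (∀ i, ContMDiffOn (𝓡 (2 * n)) 𝓘(ℝ, ℝ) ∞ (F i) V) ∧
    (∀ i, ∀ x ∈ V, poissonBracket Ω H (F i) x = 0) ∧
    (∀ i j, ∀ x ∈ V, poissonBracket Ω (F i) (F j) x = 0) ∧
    V ⊆ closure {x ∈ V | LinearIndependent ℝ (fun i => differential (d := 2 * n) (F i) x)}

/-- A point of the torus `𝕋ⁿ` given by angles. -/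
def torusPoint (t : Fin n → ℝ) : Fin n → Circle := fun i => Circle.exp (t i)

/-- `(θ, I) : W → 𝕋ⁿ × D` are action-angle coordinates on the open set `W`: a diffeomorphism onto
`𝕋ⁿ × D`, with `D ⊆ ℝⁿ` open, in which `Ω = ∑ dIᵢ ∧ dθᵢ`.
Functions on, and maps from, `𝕋ⁿ × D` are smooth if and only if their lifts to `ℝⁿ × D` are. -/
structure IsActionAngleChart (Ω : TwoForm (2 * n) M) (W : Set M) (D : Set (Fin n → ℝ))
    (θ : M → Fin n → Circle) (I : M → Fin n → ℝ) : Prop where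
  isOpen_source : IsOpen W
  isOpen_target : IsOpen D
  bijOn : Set.BijOn (fun x => (θ x, I x)) W (Set.univ ×ˢ D)
  smooth_angle : ∀ i, ContMDiffOn (𝓡 (2 * n)) (𝓡 1) ∞ (fun x => θ x i) W
  smooth_action : ∀ i, ContMDiffOn (𝓡 (2 * n)) 𝓘(ℝ, ℝ) ∞ (fun x => I x i) W
  smooth_inverse : ∃ Ψ : (Fin n → Circle) → (Fin n → ℝ) → M,
    (∀ x ∈ W, Ψ (θ x) (I x) = x) ∧
    ContMDiffOn 𝓘(ℝ, (Fin n → ℝ) × (Fin n → ℝ)) (𝓡 (2 * n)) ∞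
      (fun p : (Fin n → ℝ) × (Fin n → ℝ) => Ψ (torusPoint p.1) p.2) (Set.univ ×ˢ D)
  canonical : ∀ x ∈ W, ∀ v w : TangentSpace (𝓡 (2 * n)) x,
    Ω x ![v, w] = ∑ i,
      (differential (fun y => I y i) x v * angleDifferential (fun y => θ y i) x w -
        differential (fun y => I y i) x w * angleDifferential (fun y => θ y i) x v)

/-- `(θ, I)` are action-angle coordinates on `W` for the Hamiltonian `H`, that is, action-angle
coordinates in which `H = h(I)`. -/
structure IsActionAngleChartFor (Ω : TwoForm (2 * n) M) (H : M → ℝ) (W : Set M)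
    (D : Set (Fin n → ℝ)) (θ : M → Fin n → Circle) (I : M → Fin n → ℝ)
    (h : (Fin n → ℝ) → ℝ) : Prop extends IsActionAngleChart Ω W D θ I where
  smooth_hamiltonian : ContDiffOn ℝ ∞ h D
  hamiltonian_eq : ∀ x ∈ W, H x = h (I x)

/-- In the coordinates `(θ, I)` on `W` one has, for all `|ε| < ε₀`,
`H₀ + ε H₁ = h₀(I) + ε h₁(θ, I; ε)` with smooth `h₀` on `D` and `h₁(·, ·; ε)` on `𝕋ⁿ × D`.
The perturbation `H₁` may depend on `ε`. -/
structure HasNearIntegrableForm (ε₀ : ℝ) (H₀ : M → ℝ) (H₁ : ℝ → M → ℝ) (W : Set M)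
    (D : Set (Fin n → ℝ)) (θ : M → Fin n → Circle) (I : M → Fin n → ℝ)
    (h₀ : (Fin n → ℝ) → ℝ) (h₁ : ℝ → (Fin n → Circle) → (Fin n → ℝ) → ℝ) : Prop where
  smooth_unperturbed : ContDiffOn ℝ ∞ h₀ D
  smooth_perturbation : ∀ ε ∈ Set.Ioo (-ε₀) ε₀, ContDiffOn ℝ ∞
    (fun p : (Fin n → ℝ) × (Fin n → ℝ) => h₁ ε (torusPoint p.1) p.2) (Set.univ ×ˢ D)
  eq : ∀ ε ∈ Set.Ioo (-ε₀) ε₀, ∀ x ∈ W,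
    H₀ x + ε * H₁ ε x = h₀ (I x) + ε * h₁ ε (θ x) (I x)

/-- The family `H_ε = H₀ + ε H₁`, `|ε| < ε₀`, is near-integrable on the open set `V`: `H₀` is
Liouville integrable on `V` and, on some nonempty open `W ⊆ V`, there are action-angle coordinates
`(θ, I)` in which `H_ε = h₀(I) + ε h₁(θ, I; ε)`. -/
def IsNearIntegrableOn (Ω : TwoForm (2 * n) M) (ε₀ : ℝ) (H₀ : M → ℝ) (H₁ : ℝ → M → ℝ)
    (V : Set M) : Prop :=
  IsLiouvilleIntegrableOn Ω H₀ V ∧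
  ∃ W ⊆ V, W.Nonempty ∧ ∃ D θ I h₀ h₁,
    IsActionAngleChart Ω W D θ I ∧ HasNearIntegrableForm ε₀ H₀ H₁ W D θ I h₀ h₁

end Integrability

/-! ### Hamiltonian group actions and symplectic strata of the reduced space -/

section Action

variable {k d : ℕ} {G : Type*} [Group G] [TopologicalSpace G]
  [ChartedSpace (EuclideanSpace ℝ (Fin k)) G]
  {M : Type*} [TopologicalSpace M] [ChartedSpace (EuclideanSpace ℝ (Fin d)) M]
  [MulAction G M]

/-- The adjoint action `Ad_g`, the derivative of `h ↦ g h g⁻¹` at the identity. -/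
def adjoint (g : G) : GroupLieAlgebra (𝓡 k) G →L[ℝ] GroupLieAlgebra (𝓡 k) G :=
  mfderiv (𝓡 k) (𝓡 k) (fun h : G => g * h * g⁻¹) 1

theorem adjoint_one (ξ : GroupLieAlgebra (𝓡 k) G) : adjoint (1 : G) ξ = ξ := by
  have h : (fun h : G => (1 : G) * h * (1 : G)⁻¹) = id := by
    funext h; simp
  unfold adjoint
  rw [h, mfderiv_id]
  rfl

section LieGroup

variable [LieGroup (𝓡 k) ∞ G]

theorem mdifferentiableAt_conj (g x : G) :
    MDifferentiableAt (𝓡 k) (𝓡 k) (fun h : G => g * h * g⁻¹) x := by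
  have h : ContMDiff (𝓡 k) (𝓡 k) ∞ (fun h : G => g * h * g⁻¹) :=
    (contMDiff_mul_right (a := g⁻¹)).comp (contMDiff_mul_left (a := g))
  exact (h x).mdifferentiableAt (by simp)

theorem adjoint_mul (g g' : G) (ξ : GroupLieAlgebra (𝓡 k) G) :
    adjoint (g * g') ξ = adjoint g (adjoint g' ξ) := by
  have h : (fun h : G => (g * g') * h * (g * g')⁻¹) =
      (fun h : G => g * h * g⁻¹) ∘ (fun h : G => g' * h * g'⁻¹) := by
    funext h; simp [mul_assoc]
  have e : g' * 1 * g'⁻¹ = 1 := by simp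
  unfold adjoint
  rw [h, mfderiv_comp (I' := 𝓡 k) (1 : G) (mdifferentiableAt_conj g _)
    (mdifferentiableAt_conj g' _)]
  change (mfderiv (𝓡 k) (𝓡 k) (fun h : G => g * h * g⁻¹) (g' * 1 * g'⁻¹) :
    EuclideanSpace ℝ (Fin k) →L[ℝ] EuclideanSpace ℝ (Fin k)) _ = _
  rw [e]
  rfl

/-- The coadjoint isotropy group `G_μ = {g : Ad_g^* μ = μ}`, where
`(Ad_g^* μ)(ξ) = μ (Ad_{g⁻¹} ξ)`. -/
def coadjointIsotropy (μ : GroupLieAlgebra (𝓡 k) G →L[ℝ] ℝ) : Subgroup G where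
  carrier := {g | ∀ ξ, μ (adjoint g⁻¹ ξ) = μ ξ}
  one_mem' := fun ξ => by rw [inv_one, adjoint_one]
  mul_mem' := fun {a b} ha hb ξ => by
    rw [mul_inv_rev, adjoint_mul, hb, ha]
  inv_mem' := fun {a} ha ξ => by
    rw [inv_inv, ← ha (adjoint a ξ), ← adjoint_mul, inv_mul_cancel, adjoint_one]

end LieGroup

/-- The infinitesimal generator `ξ_M` of the action. -/
def infinitesimalGenerator (ξ : GroupLieAlgebra (𝓡 k) G) (x : M) : TangentSpace (𝓡 d) x :=
  (mfderiv (𝓡 k) (𝓡 d) (fun g : G => g • x) 1 :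
    GroupLieAlgebra (𝓡 k) G →L[ℝ] EuclideanSpace ℝ (Fin d)) ξ

/-- `J : M → 𝔤^*` is an equivariant momentum map for an action of `G` by symplectomorphisms:
`d⟨J, ξ⟩ = ι_{ξ_M} Ω` and `J(g x) = Ad_g^* J(x)`. -/
structure IsHamiltonianAction (Ω : TwoForm d M)
    (J : M → GroupLieAlgebra (𝓡 k) G →L[ℝ] ℝ) : Prop where
  symplectic : ∀ g : G, pullback (fun x : M => g • x) Ω = Ω
  smooth : ∀ ξ, ContMDiff (𝓡 d) 𝓘(ℝ, ℝ) ∞ (fun x => J x ξ)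
  momentum : ∀ ξ x, ∀ v : TangentSpace (𝓡 d) x,
    differential (fun y => J y ξ) x v = Ω x ![infinitesimalGenerator ξ x, v]
  equivariant : ∀ (g : G) x ξ, J (g • x) ξ = J x (adjoint g⁻¹ ξ)

end Action

section Reduction

variable {k : ℕ} {G : Type*} [Group G] [TopologicalSpace G]
  [ChartedSpace (EuclideanSpace ℝ (Fin k)) G] [LieGroup (𝓡 k) ∞ G]
  {M : Type*} [TopologicalSpace M] [MulAction G M]

/-- The relation "in the same `G_μ`-orbit" on the momentum level `J_μ = J⁻¹(μ)`. -/
abbrev levelSetoid (J : M → GroupLieAlgebra (𝓡 k) G →L[ℝ] ℝ)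
    (μ : GroupLieAlgebra (𝓡 k) G →L[ℝ] ℝ) : Setoid (J ⁻¹' {μ}) :=
  (MulAction.orbitRel (coadjointIsotropy μ) M).comap Subtype.val

/-- The reduced space `M_μ = J_μ / G_μ`, with the quotient topology. -/
abbrev ReducedSpace (J : M → GroupLieAlgebra (𝓡 k) G →L[ℝ] ℝ)
    (μ : GroupLieAlgebra (𝓡 k) G →L[ℝ] ℝ) : Type _ :=
  Quotient (levelSetoid J μ)

variable {J : M → GroupLieAlgebra (𝓡 k) G →L[ℝ] ℝ} {μ : GroupLieAlgebra (𝓡 k) G →L[ℝ] ℝ}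

/-- The quotient map `π_μ : J_μ → M_μ`. -/
def quotientMap (x : J ⁻¹' {μ}) : ReducedSpace J μ := Quotient.mk (levelSetoid J μ) x

/-- The image in `M_μ` of the points of `J_μ` of the same orbit type as `x₀`, i.e. whose stabilizer
is conjugate to that of `x₀` (the conjugates of `G_{x₀}` are the stabilizers `G_{g x₀}`). -/
def orbitTypeSet (x₀ : J ⁻¹' {μ}) : Set (ReducedSpace J μ) :=
  quotientMap '' {x | ∃ g : G,
    MulAction.stabilizer G (x : M) = MulAction.stabilizer G (g • (x₀ : M))}

/-- The stratum of `M_μ` through `[x₀]`: the connected component of `[x₀]` in its orbit type set,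
with the subspace topology. -/
def stratum (x₀ : J ⁻¹' {μ}) : Set (ReducedSpace J μ) :=
  connectedComponentIn (orbitTypeSet x₀) (quotientMap x₀)

/-- The preimage `π_μ⁻¹(𝒮) ⊆ J_μ` of the stratum, as a subset of `M`. -/
def stratumPreimage (x₀ : J ⁻¹' {μ}) : Set M :=
  Subtype.val '' (quotientMap ⁻¹' stratum x₀)

theorem mem_level_of_mem {x₀ : J ⁻¹' {μ}} {x : M} (hx : x ∈ stratumPreimage x₀) :
    x ∈ J ⁻¹' {μ} := by
  obtain ⟨y, -, rfl⟩ := hx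
  exact y.2

theorem quotientMap_mem {x₀ : J ⁻¹' {μ}} {x : M} (hx : x ∈ stratumPreimage x₀) :
    quotientMap ⟨x, mem_level_of_mem hx⟩ ∈ stratum x₀ := by
  obtain ⟨y, hy, rfl⟩ := hx
  exact hy

/-- The restriction `π_μ⁻¹(𝒮) → 𝒮` of the quotient map. -/
def stratumProjection (x₀ : J ⁻¹' {μ}) (x : stratumPreimage x₀) : stratum x₀ :=
  ⟨quotientMap ⟨x, mem_level_of_mem x.2⟩, quotientMap_mem x.2⟩

/-- The restriction `π = π_μ ∘ ι : N → 𝒮` of the quotient map to a subset `N` of `π_μ⁻¹(𝒮)`. -/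
def sliceProjection {x₀ : J ⁻¹' {μ}} {N : Set M} (hN : N ⊆ stratumPreimage x₀) (x : N) :
    stratum x₀ :=
  stratumProjection x₀ ⟨x, hN x.2⟩

/-- The function on the stratum induced by a `G`-invariant function `F` on `M`: its value at an
orbit is the value of `F` at any point of the orbit. -/
def reducedFunction (F : M → ℝ) (x₀ : J ⁻¹' {μ}) (s : stratum x₀) : ℝ :=
  F ((s : ReducedSpace J μ).out : J ⁻¹' {μ})

theorem reducedFunction_stratumProjection {F : M → ℝ} (hF : ∀ (g : G) x, F (g • x) = F x)
    (x₀ : J ⁻¹' {μ}) (x : stratumPreimage x₀) :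
    reducedFunction F x₀ (stratumProjection x₀ x) = F x := by
  obtain ⟨g, hg⟩ := Quotient.mk_out (s := levelSetoid J μ) ⟨(x : M), mem_level_of_mem x.2⟩
  exact (congrArg F hg.symm).trans (hF g x)

/-- The smooth structure and the reduced symplectic form of the stratum `𝒮`, with
`P = π_μ⁻¹(𝒮)`: `P` is an embedded submanifold of `M`, the projection `P → 𝒮` is a (surjective)
submersion, and `Ω_𝒮` is the symplectic form on `𝒮` whose pullback to `P` is the restriction of `Ω`.
These conditions determine the smooth structures of `P` and `𝒮` and the form `Ω_𝒮`. -/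
structure IsReducedSymplecticStratum {d p s : ℕ}
    [ChartedSpace (EuclideanSpace ℝ (Fin d)) M] (Ω : TwoForm d M) (x₀ : J ⁻¹' {μ})
    [ChartedSpace (EuclideanSpace ℝ (Fin p)) (stratumPreimage x₀)]
    [ChartedSpace (EuclideanSpace ℝ (Fin s)) (stratum x₀)]
    (ΩS : TwoForm s (stratum x₀)) : Prop where
  manifold_preimage : IsManifold (𝓡 p) ∞ (stratumPreimage x₀)
  manifold_stratum : IsManifold (𝓡 s) ∞ (stratum x₀)
  embedding : Manifold.IsSmoothEmbedding (𝓡 p) (𝓡 d) ∞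
    (Subtype.val : stratumPreimage x₀ → M)
  submersion : Manifold.IsSubmersion (𝓡 p) (𝓡 s) ∞ (stratumProjection x₀)
  symplectic : IsSymplecticForm ΩS
  pullback_eq : pullback (d := p) (stratumProjection x₀) ΩS =
    pullback (d := p) (Subtype.val : stratumPreimage x₀ → M) Ω

end Reduction

/-- `N ⊆ M` is an (embedded) symplectic submanifold of `(M, Ω)`. -/
structure IsSymplecticSubmanifold {d s : ℕ} {M : Type*} [TopologicalSpace M]
    [ChartedSpace (EuclideanSpace ℝ (Fin d)) M] (Ω : TwoForm d M) (N : Set M)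
    [ChartedSpace (EuclideanSpace ℝ (Fin s)) N] : Prop where
  manifold : IsManifold (𝓡 s) ∞ N
  embedding : Manifold.IsSmoothEmbedding (𝓡 s) (𝓡 d) ∞ (Subtype.val : N → M)
  nondegenerate : Nondegenerate (pullback (d := s) (Subtype.val : N → M) Ω)

/-- The symplectic form `Ω|_N` of a symplectic submanifold. -/
abbrev restrictForm {d s : ℕ} {M : Type*} [TopologicalSpace M]
    [ChartedSpace (EuclideanSpace ℝ (Fin d)) M] (Ω : TwoForm d M) (N : Set M)
    [ChartedSpace (EuclideanSpace ℝ (Fin s)) N] : TwoForm s N :=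
  pullback (Subtype.val : N → M) Ω

end MomentumSlice

end

open MomentumSlice

/-! The projection `π` of the slice is a symplectic diffeomorphism of `N` onto the open set `US`,
and it carries each invariant function restricted to `N` to its reduced function. All the notions
involved are natural under symplectic diffeomorphisms, so they transfer.

For the forms, `π` is the inclusion of `N` into the preimage `P` of the stratum followed by the
submersion of `P` onto the stratum. The reduced form and `Ω` have the same pullback to `P`, hence
the same pullback to `N` (`pullback_sliceProjection`). For the functions, a `G`-invariant function
is constant on orbits (`reducedFunction_stratumProjection`).

Naturality is proved for any diffeomorphism `φ` onto an open set, with the source carrying the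
pulled-back form. The derivative of `φ` is bijective, so it matches differentials, Hamiltonian
vector fields and brackets (`poissonBracket_comp`), independence of differentials, and the canonical
form `∑ dIᵢ ∧ dθᵢ` (`isActionAngleChart_iff`). Data on the source is transported back by the inverse
`σ`. -/

namespace MomentumSlice

namespace IsDiffeomorphOnto

/-! ### Calculus along a diffeomorphism onto an open set. -/

section General

variable {d d' : ℕ} {M M' : Type*} [TopologicalSpace M]
  [ChartedSpace (EuclideanSpace ℝ (Fin d)) M] [TopologicalSpace M']
  [ChartedSpace (EuclideanSpace ℝ (Fin d')) M'] {φ : M → M'} {U W : Set M'}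

/-- The image of an open set is its preimage under the inverse `σ`, cut down to `U`; it is open
because `σ` is continuous on the open set `U`. -/
theorem isOpenEmbedding (hφ : IsDiffeomorphOnto (d := d) (d' := d') φ U) :
    Topology.IsOpenEmbedding φ := by
  obtain ⟨σ, hσ, hl, hr⟩ := hφ.exists_inverse
  refine .of_continuous_injective_isOpenMap hφ.smooth.continuous
    (Function.LeftInverse.injective hl) fun V hV => ?_
  have h : φ '' V = U ∩ σ ⁻¹' V := by
    ext y
    constructor
    · rintro ⟨x, hx, rfl⟩
      exact ⟨hφ.mapsTo x, by simpa [hl] using hx⟩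
    · rintro ⟨hy, hy'⟩
      exact ⟨σ y, hy', hr y hy⟩
  rw [h]
  exact hσ.continuousOn.isOpen_inter_preimage hφ.isOpen hV

theorem range_eq (hφ : IsDiffeomorphOnto (d := d) (d' := d') φ U) : Set.range φ = U := by
  obtain ⟨σ, -, -, hr⟩ := hφ.exists_inverse
  refine Set.Subset.antisymm (Set.range_subset_iff.2 hφ.mapsTo) fun y hy => ⟨σ y, hr y hy⟩

theorem image_preimage (hφ : IsDiffeomorphOnto (d := d) (d' := d') φ U) (hW : W ⊆ U) :
    φ '' (φ ⁻¹' W) = W :=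
  Set.image_preimage_eq_of_subset (hφ.range_eq.symm ▸ hW)

theorem isOpen_preimage_iff (hφ : IsDiffeomorphOnto (d := d) (d' := d') φ U) (hW : W ⊆ U) :
    IsOpen (φ ⁻¹' W) ↔ IsOpen W :=
  (hφ.isOpenEmbedding.isOpen_iff_preimage_isOpen (hφ.range_eq.symm ▸ hW)).symm

/-- Preimage under an open continuous map commutes with closure. This transfers the density clause
of Liouville integrability. -/
theorem preimage_subset_closure_iff (hφ : IsDiffeomorphOnto (d := d) (d' := d') φ U)
    (hW : W ⊆ U) (S : Set M') : φ ⁻¹' W ⊆ closure (φ ⁻¹' S) ↔ W ⊆ closure S := by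
  rw [← hφ.isOpenEmbedding.isOpenMap.preimage_closure_eq_closure_preimage
    hφ.isOpenEmbedding.continuous]
  exact Set.preimage_subset_preimage_iff (hφ.range_eq.symm ▸ hW)

theorem mdifferentiableAt (hφ : IsDiffeomorphOnto (d := d) (d' := d') φ U) (x : M) :
    MDifferentiableAt (𝓡 d) (𝓡 d') φ x :=
  (hφ.smooth x).mdifferentiableAt (by simp)

/-- Differentiate `σ ∘ φ = id` at `x` and `φ ∘ σ = id` at `φ x`; the latter identity holds only on
`U`, a neighbourhood of `φ x`. -/
theorem bijective_mfderiv (hφ : IsDiffeomorphOnto (d := d) (d' := d') φ U) (x : M) :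
    Function.Bijective (mfderiv (𝓡 d) (𝓡 d') φ x) := by
  obtain ⟨σ, hσ, hl, hr⟩ := hφ.exists_inverse
  have hU : U ∈ nhds (φ x) := hφ.isOpen.mem_nhds (hφ.mapsTo x)
  have hσx : HasMFDerivAt (𝓡 d') (𝓡 d) σ (φ x) (mfderiv (𝓡 d') (𝓡 d) σ (φ x)) :=
    ((hσ.contMDiffAt hU).mdifferentiableAt (by simp)).hasMFDerivAt
  have hφx := (hφ.mdifferentiableAt x).hasMFDerivAt
  -- The chain rule for `φ ∘ σ` needs the derivative of `φ` at `σ (φ x)`, which equals `x` but not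
  -- definitionally; typing it on the model spaces allows the rewrite.
  have hφσ : HasMFDerivAt (𝓡 d) (𝓡 d') φ (σ (φ x))
      (mfderiv (𝓡 d) (𝓡 d') φ x : EuclideanSpace ℝ (Fin d) →L[ℝ] EuclideanSpace ℝ (Fin d')) := by
    rw [hl x]
    exact hφx
  have h₁ := hasMFDerivAt_unique (hσx.comp x hφx)
    ((hasMFDerivAt_id x).congr_of_eventuallyEq (Filter.Eventually.of_forall hl))
  have h₂ := hasMFDerivAt_unique (hφσ.comp (φ x) hσx)
    ((hasMFDerivAt_id (φ x)).congr_of_eventuallyEq (Filter.mem_of_superset hU hr))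
  exact Function.bijective_iff_has_inverse.2 ⟨mfderiv (𝓡 d') (𝓡 d) σ (φ x),
    fun v => DFunLike.congr_fun h₁ v, fun v => DFunLike.congr_fun h₂ v⟩

/-- Smoothness is invariant under composition with a diffeomorphism. -/
theorem contMDiffOn_comp_iff (hφ : IsDiffeomorphOnto (d := d) (d' := d') φ U) (hW : W ⊆ U)
    {E H P : Type*} [NormedAddCommGroup E] [NormedSpace ℝ E] [TopologicalSpace H]
    {J : ModelWithCorners ℝ E H} [TopologicalSpace P] [ChartedSpace H P] {f : M' → P} :
    ContMDiffOn (𝓡 d) J ∞ (fun x => f (φ x)) (φ ⁻¹' W) ↔ ContMDiffOn (𝓡 d') J ∞ f W := by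
  refine ⟨fun h => ?_, fun h => h.comp hφ.smooth.contMDiffOn (fun _ hx => hx)⟩
  obtain ⟨σ, hσ, -, hr⟩ := hφ.exists_inverse
  refine (h.comp (hσ.mono hW) fun y hy => ?_).congr fun y hy => ?_
  · simpa [hr y (hW hy)] using hy
  · simp [hr y (hW hy)]

/-- The chain rule for composition with a diffeomorphism; the outer function is arbitrary. -/
theorem mfderiv_comp_apply (hφ : IsDiffeomorphOnto (d := d) (d' := d') φ U)
    {E : Type*} [NormedAddCommGroup E] [NormedSpace ℝ E] (f : M' → E) (x : M)
    (v : TangentSpace (𝓡 d) x) :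
    mfderiv (𝓡 d) 𝓘(ℝ, E) (fun y => f (φ y)) x v =
      mfderiv (𝓡 d') 𝓘(ℝ, E) f (φ x) (mfderiv (𝓡 d) (𝓡 d') φ x v) := by
  by_cases hf : MDifferentiableAt (𝓡 d') 𝓘(ℝ, E) f (φ x)
  · exact DFunLike.congr_fun (mfderiv_comp x hf (hφ.mdifferentiableAt x)) v
  -- Near `φ x` one has `f = (f ∘ φ) ∘ σ`, so `f` and `f ∘ φ` fail to be differentiable together,
  -- and both derivatives take the default value `0`.
  · have hf' : ¬ MDifferentiableAt (𝓡 d) 𝓘(ℝ, E) (fun y => f (φ y)) x := by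
      intro h
      obtain ⟨σ, hσ, hl, hr⟩ := hφ.exists_inverse
      have hU : U ∈ nhds (φ x) := hφ.isOpen.mem_nhds (hφ.mapsTo x)
      refine hf ((MDifferentiableAt.comp (φ x) (g := fun y => f (φ y)) (by rwa [hl x])
        ((hσ.contMDiffAt hU).mdifferentiableAt (by simp))).congr_of_eventuallyEq ?_)
      filter_upwards [hU] with y hy
      simp [hr y hy]
    rw [mfderiv_zero_of_not_mdifferentiableAt hf, mfderiv_zero_of_not_mdifferentiableAt hf']
    rfl

theorem differential_comp (hφ : IsDiffeomorphOnto (d := d) (d' := d') φ U) (f : M' → ℝ) (x : M)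
    (v : TangentSpace (𝓡 d) x) :
    differential (d := d) (fun y => f (φ y)) x v =
      differential f (φ x) (mfderiv (𝓡 d) (𝓡 d') φ x v) :=
  hφ.mfderiv_comp_apply f x v

theorem angleDifferential_comp (hφ : IsDiffeomorphOnto (d := d) (d' := d') φ U)
    (z : M' → Circle) (x : M) (v : TangentSpace (𝓡 d) x) :
    angleDifferential (d := d) (fun y => z (φ y)) x v =
      angleDifferential z (φ x) (mfderiv (𝓡 d) (𝓡 d') φ x v) :=
  congrArg (fun c : ℂ => (star (z (φ x) : ℂ) * c).im)
    (hφ.mfderiv_comp_apply (fun y => (z y : ℂ)) x v)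

theorem pullback_apply (φ : M → M') (Ω : TwoForm d' M') (x : M) (v w : TangentSpace (𝓡 d) x) :
    pullback φ Ω x ![v, w] =
      Ω (φ x) ![mfderiv (𝓡 d) (𝓡 d') φ x v, mfderiv (𝓡 d) (𝓡 d') φ x w] := by
  refine congrArg (Ω (φ x)) (funext fun i => ?_)
  fin_cases i <;> rfl

theorem hamiltonianVectorField_unique {Ω : TwoForm d M} (hΩ : Nondegenerate Ω) {f : M → ℝ}
    {x : M} {v : TangentSpace (𝓡 d) x}
    (hv : ∀ w : TangentSpace (𝓡 d) x, Ω x ![v, w] = -differential f x w) :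
    hamiltonianVectorField Ω f x = v := by
  have h : ∃ v : TangentSpace (𝓡 d) x,
      ∀ w : TangentSpace (𝓡 d) x, Ω x ![v, w] = -differential f x w := ⟨v, hv⟩
  rw [hamiltonianVectorField, dif_pos h]
  refine sub_eq_zero.1 (hΩ x _ fun w => ?_)
  -- Additivity of an alternating map in one slot is expressed through `Function.update`; this
  -- identifies updating slot `0` with replacing the first vector.
  have hu : ∀ u : TangentSpace (𝓡 d) x, Function.update ![v, w] 0 u = ![u, w] := fun u => by
    ext1 i
    fin_cases i <;> rfl
  have h' := (Ω x).map_update_sub ![v, w] 0 h.choose v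
  rw [hu, hu, hu] at h'
  exact h'.trans (sub_eq_zero.2 ((h.choose_spec w).trans (hv w).symm))

/-- As the derivative of `φ` is onto, a vector solves the defining equation for the pulled-back form
exactly when its image solves the one for `Ω`. Nondegeneracy serves only for uniqueness: if there is
no solution, both fields take the default `0`, so existence need not be proved. -/
theorem mfderiv_hamiltonianVectorField (hφ : IsDiffeomorphOnto (d := d) (d' := d') φ U)
    {Ω : TwoForm d' M'} (hΩ : Nondegenerate Ω) (f : M' → ℝ) (x : M) :
    mfderiv (𝓡 d) (𝓡 d') φ x (hamiltonianVectorField (pullback φ Ω) (fun y => f (φ y)) x) =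
      hamiltonianVectorField Ω f (φ x) := by
  by_cases h : ∃ v : TangentSpace (𝓡 d) x, ∀ w : TangentSpace (𝓡 d) x,
      pullback φ Ω x ![v, w] = -differential (d := d) (fun y => f (φ y)) x w
  · refine (hamiltonianVectorField_unique hΩ fun w => ?_).symm
    obtain ⟨w, rfl⟩ := (hφ.bijective_mfderiv x).2 w
    rw [← pullback_apply, hamiltonianVectorField, dif_pos h, h.choose_spec w,
      hφ.differential_comp]
  · have h' : ¬ ∃ v : TangentSpace (𝓡 d') (φ x), ∀ w : TangentSpace (𝓡 d') (φ x),
        Ω (φ x) ![v, w] = -differential f (φ x) w := by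
      rintro ⟨v, hv⟩
      obtain ⟨v, rfl⟩ := (hφ.bijective_mfderiv x).2 v
      exact h ⟨v, fun w => by rw [pullback_apply, hv, hφ.differential_comp]⟩
    rw [hamiltonianVectorField, dif_neg h, hamiltonianVectorField, dif_neg h', map_zero]

/-- A symplectic diffeomorphism preserves Poisson brackets. -/
theorem poissonBracket_comp (hφ : IsDiffeomorphOnto (d := d) (d' := d') φ U)
    {Ω : TwoForm d' M'} (hΩ : Nondegenerate Ω) (f g : M' → ℝ) (x : M) :
    poissonBracket (pullback (d := d) φ Ω) (fun y => f (φ y)) (fun y => g (φ y)) x =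
      poissonBracket Ω f g (φ x) := by
  rw [poissonBracket, hφ.differential_comp, hφ.mfderiv_hamiltonianVectorField hΩ, poissonBracket]

theorem linearIndependent_differential_comp_iff
    (hφ : IsDiffeomorphOnto (d := d) (d' := d') φ U) {ι : Type*} (F : ι → M' → ℝ) (x : M) :
    LinearIndependent ℝ (fun i => differential (d := d) (fun y => F i (φ y)) x) ↔
      LinearIndependent ℝ (fun i => differential (d := d') (F i) (φ x)) := by
  let A : EuclideanSpace ℝ (Fin d) →L[ℝ] EuclideanSpace ℝ (Fin d') := mfderiv (𝓡 d) (𝓡 d') φ x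
  have hA : Function.Bijective A := hφ.bijective_mfderiv x
  let T : (EuclideanSpace ℝ (Fin d') →L[ℝ] ℝ) →ₗ[ℝ] EuclideanSpace ℝ (Fin d) →L[ℝ] ℝ :=
    { toFun := fun l => l.comp A
      map_add' := fun _ _ => rfl
      map_smul' := fun _ _ => rfl }
  -- Precomposition with a surjective map is injective, so it preserves and reflects linear
  -- independence.
  have hT : LinearMap.ker T = ⊥ := by
    refine LinearMap.ker_eq_bot.2 fun l l' h => ContinuousLinearMap.ext fun v => ?_
    obtain ⟨v, rfl⟩ := hA.2 v
    exact DFunLike.congr_fun h v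
  have h : (fun i => differential (d := d) (fun y => F i (φ y)) x) =
      T ∘ fun i => differential (d := d') (F i) (φ x) :=
    funext fun i => ContinuousLinearMap.ext fun v => hφ.differential_comp (F i) x v
  rw [h]
  exact T.linearIndependent_iff hT

end General

/-! ### Integrability notions under a symplectic diffeomorphism. -/

section Integrability

variable {n : ℕ} {M M' : Type*} [TopologicalSpace M]
  [ChartedSpace (EuclideanSpace ℝ (Fin (2 * n))) M] [TopologicalSpace M']
  [ChartedSpace (EuclideanSpace ℝ (Fin (2 * n))) M'] {φ : M → M'} {U W : Set M'}

theorem isLiouvilleIntegrableOn_iff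
    (hφ : IsDiffeomorphOnto (d := 2 * n) (d' := 2 * n) φ U)
    {Ω : TwoForm (2 * n) M'} (hΩ : Nondegenerate Ω) (H : M' → ℝ) (hW : W ⊆ U) :
    IsLiouvilleIntegrableOn (pullback (d := 2 * n) φ Ω) (fun x => H (φ x)) (φ ⁻¹' W) ↔
      IsLiouvilleIntegrableOn Ω H W := by
  have key : ∀ F : Fin n → M' → ℝ,
      ((∀ i, ContMDiffOn (𝓡 (2 * n)) 𝓘(ℝ, ℝ) ∞ (fun x => F i (φ x)) (φ ⁻¹' W)) ∧
        (∀ i, ∀ x ∈ φ ⁻¹' W,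
          poissonBracket (pullback (d := 2 * n) φ Ω) (fun x => H (φ x)) (fun x => F i (φ x)) x = 0) ∧
        (∀ i j, ∀ x ∈ φ ⁻¹' W,
          poissonBracket (pullback (d := 2 * n) φ Ω) (fun x => F i (φ x)) (fun x => F j (φ x)) x = 0) ∧
        φ ⁻¹' W ⊆ closure {x ∈ φ ⁻¹' W |
          LinearIndependent ℝ (fun i => differential (d := 2 * n) (fun x => F i (φ x)) x)}) ↔
      ((∀ i, ContMDiffOn (𝓡 (2 * n)) 𝓘(ℝ, ℝ) ∞ (F i) W) ∧
        (∀ i, ∀ x ∈ W, poissonBracket Ω H (F i) x = 0) ∧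
        (∀ i j, ∀ x ∈ W, poissonBracket Ω (F i) (F j) x = 0) ∧
        W ⊆ closure {x ∈ W | LinearIndependent ℝ (fun i => differential (d := 2 * n) (F i) x)}) := by
    intro F
    have hall : ∀ p : M' → Prop, (∀ x ∈ φ ⁻¹' W, p (φ x)) ↔ ∀ y ∈ W, p y := fun p => by
      rw [← Set.forall_mem_image, hφ.image_preimage hW]
    simp only [hφ.contMDiffOn_comp_iff hW, hφ.poissonBracket_comp hΩ,
      hφ.linearIndependent_differential_comp_iff]
    refine and_congr_right' (and_congr (forall_congr' fun i => ?_)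
      (and_congr (forall_congr' fun i => forall_congr' fun j => ?_) ?_))
    · exact hall fun y => poissonBracket Ω H (F i) y = 0
    · exact hall fun y => poissonBracket Ω (F i) (F j) y = 0
    · exact hφ.preimage_subset_closure_iff hW
        {y ∈ W | LinearIndependent ℝ fun i => differential (d := 2 * n) (F i) y}
  constructor
  · rintro ⟨F, hF⟩
    obtain ⟨σ, -, hl, -⟩ := hφ.exists_inverse
    -- Since `σ ∘ φ = id` everywhere, every family on `M` is a composite with `φ`, and `key` applies
    -- to it too.
    have h : F = fun i x => (F i ∘ σ) (φ x) := by
      funext i x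
      simp [hl]
    rw [h] at hF
    exact ⟨fun i => F i ∘ σ, (key _).1 hF⟩
  · rintro ⟨F, hF⟩
    exact ⟨fun i x => F i (φ x), (key F).2 hF⟩

theorem isActionAngleChart_iff
    (hφ : IsDiffeomorphOnto (d := 2 * n) (d' := 2 * n) φ U)
    (Ω : TwoForm (2 * n) M') (hW : W ⊆ U) (D : Set (Fin n → ℝ))
    (θ : M' → Fin n → Circle) (I : M' → Fin n → ℝ) :
    IsActionAngleChart (pullback (d := 2 * n) φ Ω) (φ ⁻¹' W) D (θ ∘ φ) (I ∘ φ) ↔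
      IsActionAngleChart Ω W D θ I := by
  have hinj : Function.Injective φ := hφ.isOpenEmbedding.injective
  have himage := hφ.image_preimage hW
  constructor
  · intro h
    have hbij : Set.BijOn (fun x => (θ x, I x)) W (Set.univ ×ˢ D) := by
      have h₁ := h.bijOn
      refine ⟨?_, ?_, ?_⟩ <;> rw [← himage]
      · rintro _ ⟨x, hx, rfl⟩
        exact h₁.mapsTo hx
      · rintro _ ⟨x, hx, rfl⟩ _ ⟨y, hy, rfl⟩ hxy
        exact congrArg φ (h₁.injOn hx hy hxy)
      · intro q hq
        obtain ⟨x, hx, hxq⟩ := h₁.surjOn hq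
        exact ⟨φ x, ⟨x, hx, rfl⟩, hxq⟩
    refine ⟨(hφ.isOpen_preimage_iff hW).1 h.isOpen_source, h.isOpen_target, hbij,
      fun i => (hφ.contMDiffOn_comp_iff hW).1 (h.smooth_angle i),
      fun i => (hφ.contMDiffOn_comp_iff hW).1 (h.smooth_action i), ?_, ?_⟩
    · obtain ⟨Ψ, hΨ, hΨs⟩ := h.smooth_inverse
      refine ⟨fun t a => φ (Ψ t a), ?_, hφ.smooth.comp_contMDiffOn hΨs⟩
      rw [← himage]
      rintro _ ⟨x, hx, rfl⟩
      exact congrArg φ (hΨ x hx)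
    · rw [← himage]
      rintro _ ⟨x, hx, rfl⟩ v w
      -- Every tangent vector at `φ x` is an image, so it suffices to test the canonical form on
      -- images.
      obtain ⟨v, rfl⟩ := (hφ.bijective_mfderiv x).2 v
      obtain ⟨w, rfl⟩ := (hφ.bijective_mfderiv x).2 w
      have hc := h.canonical x hx v w
      simp only [Function.comp_apply] at hc
      rw [← pullback_apply, hc]
      refine Finset.sum_congr rfl fun i _ => ?_
      rw [hφ.differential_comp (fun y => I y i), hφ.differential_comp (fun y => I y i),
        hφ.angleDifferential_comp (fun y => θ y i), hφ.angleDifferential_comp (fun y => θ y i)]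
  · intro h
    have hbij := h.bijOn
    refine ⟨(hφ.isOpen_preimage_iff hW).2 h.isOpen_source, h.isOpen_target, ⟨?_, ?_, ?_⟩,
      fun i => (hφ.contMDiffOn_comp_iff hW).2 (h.smooth_angle i),
      fun i => (hφ.contMDiffOn_comp_iff hW).2 (h.smooth_action i), ?_, ?_⟩
    · exact fun x hx => hbij.mapsTo hx
    · exact fun x hx y hy hxy => hinj (hbij.injOn hx hy hxy)
    · intro q hq
      obtain ⟨y, hy, hyq⟩ := hbij.surjOn hq
      rw [← himage] at hy
      obtain ⟨x, hx, rfl⟩ := hy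
      exact ⟨x, hx, hyq⟩
    · obtain ⟨Ψ, hΨ, hΨs⟩ := h.smooth_inverse
      obtain ⟨σ, hσ, hl, -⟩ := hφ.exists_inverse
      refine ⟨fun t a => σ (Ψ t a), fun x hx => ?_, hσ.comp hΨs fun q hq => ?_⟩
      · simp [hΨ (φ x) hx, hl]
      -- Since `σ` is smooth only on `U`, the values of `Ψ` must lie there. Surjectivity of the
      -- chart writes the point of `𝕋ⁿ × D` as the coordinates of some `y ∈ W`, and `Ψ` returns that
      -- `y`.
      · obtain ⟨y, hy, hyq⟩ := hbij.surjOn (show (torusPoint q.1, q.2) ∈ Set.univ ×ˢ D from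
          ⟨trivial, hq.2⟩)
        obtain ⟨h₁, h₂⟩ := Prod.mk.inj hyq
        simp only [Set.mem_preimage, ← h₁, ← h₂, hΨ y hy]
        exact hW hy
    · intro x hx v w
      simp only [Function.comp_apply]
      rw [pullback_apply, h.canonical (φ x) hx]
      refine Finset.sum_congr rfl fun i _ => ?_
      rw [hφ.differential_comp (fun y => I y i), hφ.differential_comp (fun y => I y i),
        hφ.angleDifferential_comp (fun y => θ y i), hφ.angleDifferential_comp (fun y => θ y i)]

theorem isActionAngleChartFor_iff
    (hφ : IsDiffeomorphOnto (d := 2 * n) (d' := 2 * n) φ U)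
    (Ω : TwoForm (2 * n) M') (H : M' → ℝ) (hW : W ⊆ U) (D : Set (Fin n → ℝ))
    (θ : M' → Fin n → Circle) (I : M' → Fin n → ℝ) (h : (Fin n → ℝ) → ℝ) :
    IsActionAngleChartFor (pullback (d := 2 * n) φ Ω) (fun x => H (φ x)) (φ ⁻¹' W) D (θ ∘ φ) (I ∘ φ) h ↔
      IsActionAngleChartFor Ω H W D θ I h := by
  constructor
  · intro hc
    refine ⟨(hφ.isActionAngleChart_iff Ω hW D θ I).1 hc.toIsActionAngleChart,
      hc.smooth_hamiltonian, ?_⟩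
    rw [← hφ.image_preimage hW, Set.forall_mem_image]
    exact hc.hamiltonian_eq
  · intro hc
    exact ⟨(hφ.isActionAngleChart_iff Ω hW D θ I).2 hc.toIsActionAngleChart,
      hc.smooth_hamiltonian, fun x hx => hc.hamiltonian_eq (φ x) hx⟩

/-- The functions `h₀`, `h₁` live on `𝕋ⁿ × D` and are untouched; only the pointwise identity moves.
Agreement of `K₁` with `H₁ ∘ φ` is asked only for `|ε| < ε₀`, the range in which the main theorem
has invariance of the perturbation. -/
theorem hasNearIntegrableForm_iff
    (hφ : IsDiffeomorphOnto (d := 2 * n) (d' := 2 * n) φ U)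
    {ε₀ : ℝ} {H₀ : M' → ℝ} {H₁ : ℝ → M' → ℝ} {K₁ : ℝ → M → ℝ}
    (hK₁ : ∀ ε ∈ Set.Ioo (-ε₀) ε₀, ∀ x, K₁ ε x = H₁ ε (φ x)) (hW : W ⊆ U)
    (D : Set (Fin n → ℝ)) (θ : M' → Fin n → Circle) (I : M' → Fin n → ℝ)
    (h₀ : (Fin n → ℝ) → ℝ) (h₁ : ℝ → (Fin n → Circle) → (Fin n → ℝ) → ℝ) :
    HasNearIntegrableForm ε₀ (fun x => H₀ (φ x)) K₁ (φ ⁻¹' W) D (θ ∘ φ) (I ∘ φ) h₀ h₁ ↔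
      HasNearIntegrableForm ε₀ H₀ H₁ W D θ I h₀ h₁ := by
  constructor
  · intro h
    refine ⟨h.smooth_unperturbed, h.smooth_perturbation, fun ε hε => ?_⟩
    rw [← hφ.image_preimage hW, Set.forall_mem_image]
    intro x hx
    rw [← hK₁ ε hε]
    exact h.eq ε hε x hx
  · intro h
    refine ⟨h.smooth_unperturbed, h.smooth_perturbation, fun ε hε x hx => ?_⟩
    rw [hK₁ ε hε]
    exact h.eq ε hε (φ x) hx

theorem isNearIntegrableOn_iff
    (hφ : IsDiffeomorphOnto (d := 2 * n) (d' := 2 * n) φ U)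
    {Ω : TwoForm (2 * n) M'} (hΩ : Nondegenerate Ω)
    {ε₀ : ℝ} {H₀ : M' → ℝ} {H₁ : ℝ → M' → ℝ} {K₁ : ℝ → M → ℝ}
    (hK₁ : ∀ ε ∈ Set.Ioo (-ε₀) ε₀, ∀ x, K₁ ε x = H₁ ε (φ x)) :
    IsNearIntegrableOn (pullback (d := 2 * n) φ Ω) ε₀ (fun x => H₀ (φ x)) K₁ Set.univ ↔
      IsNearIntegrableOn Ω ε₀ H₀ H₁ U := by
  have huniv : φ ⁻¹' U = Set.univ := Set.eq_univ_of_forall hφ.mapsTo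
  refine and_congr (huniv ▸ hφ.isLiouvilleIntegrableOn_iff hΩ H₀ subset_rfl) ⟨?_, ?_⟩
  · rintro ⟨V, -, hV, D, θ, I, h₀, h₁, hc, hf⟩
    obtain ⟨σ, -, hl, -⟩ := hφ.exists_inverse
    -- A chart on `V` in the source becomes the chart `(θ ∘ σ, I ∘ σ)` on `φ '' V`. The values of
    -- `σ` off `U` do not matter, because composing with `φ` gives back `θ` and `I`.
    have hVU : φ '' V ⊆ U := Set.image_subset_iff.2 fun x _ => hφ.mapsTo x
    have hV' : φ ⁻¹' (φ '' V) = V := Set.preimage_image_eq V hφ.isOpenEmbedding.injective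
    have hθ : (θ ∘ σ) ∘ φ = θ := funext fun x => congrArg θ (hl x)
    have hI : (I ∘ σ) ∘ φ = I := funext fun x => congrArg I (hl x)
    refine ⟨φ '' V, hVU, hV.image φ, D, θ ∘ σ, I ∘ σ, h₀, h₁,
      (hφ.isActionAngleChart_iff Ω hVU D _ _).1 ?_,
      (hφ.hasNearIntegrableForm_iff hK₁ hVU D _ _ h₀ h₁).1 ?_⟩
    · rwa [hV', hθ, hI]
    · rwa [hV', hθ, hI]
  · rintro ⟨W, hW, hne, D, θ, I, h₀, h₁, hc, hf⟩
    refine ⟨φ ⁻¹' W, Set.subset_univ _, ?_, D, θ ∘ φ, I ∘ φ, h₀, h₁,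
      (hφ.isActionAngleChart_iff Ω hW D θ I).2 hc,
      (hφ.hasNearIntegrableForm_iff hK₁ hW D θ I h₀ h₁).2 hf⟩
    rw [← hφ.image_preimage hW] at hne
    exact hne.of_image

end Integrability

end IsDiffeomorphOnto

/-! ### The restricted form on a slice as the pullback of the reduced form. -/

section Slice

variable {k : ℕ} {G : Type*} [Group G] [TopologicalSpace G]
  [ChartedSpace (EuclideanSpace ℝ (Fin k)) G] [LieGroup (𝓡 k) ∞ G]
  {M : Type*} [TopologicalSpace M] [MulAction G M]
  {J : M → GroupLieAlgebra (𝓡 k) G →L[ℝ] ℝ} {μ : GroupLieAlgebra (𝓡 k) G →L[ℝ] ℝ}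

theorem pullback_comp {d d' d'' : ℕ} {M M' M'' : Type*} [TopologicalSpace M]
    [ChartedSpace (EuclideanSpace ℝ (Fin d)) M] [TopologicalSpace M']
    [ChartedSpace (EuclideanSpace ℝ (Fin d')) M'] [TopologicalSpace M'']
    [ChartedSpace (EuclideanSpace ℝ (Fin d'')) M''] {φ : M → M'} {ψ : M' → M''}
    (hψ : MDifferentiable (𝓡 d') (𝓡 d'') ψ) (hφ : MDifferentiable (𝓡 d) (𝓡 d') φ)
    (Ω : TwoForm d'' M'') :
    pullback (d := d) (ψ ∘ φ) Ω = pullback φ (pullback (d := d') ψ Ω) := by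
  funext x
  unfold pullback
  rw [mfderiv_comp x (hψ (φ x)) (hφ x)]
  rfl

/-- The restriction of `Ω` to a submanifold `N` of the preimage of a stratum is the pullback of the
reduced symplectic form. -/
theorem IsReducedSymplecticStratum.pullback_sliceProjection {d p s r : ℕ}
    [ChartedSpace (EuclideanSpace ℝ (Fin d)) M] [IsManifold (𝓡 d) ∞ M]
    {Ω : TwoForm d M} {x₀ : J ⁻¹' {μ}}
    [ChartedSpace (EuclideanSpace ℝ (Fin p)) (stratumPreimage x₀)]
    [ChartedSpace (EuclideanSpace ℝ (Fin s)) (stratum x₀)]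
    {ΩS : TwoForm s (stratum x₀)} (hS : IsReducedSymplecticStratum (p := p) Ω x₀ ΩS)
    {N : Set M} [ChartedSpace (EuclideanSpace ℝ (Fin r)) N] (hN : N ⊆ stratumPreimage x₀)
    (hN_symp : IsSymplecticSubmanifold (s := r) Ω N) :
    pullback (d := r) (sliceProjection hN) ΩS = restrictForm (s := r) Ω N := by
  have := hS.manifold_preimage
  have := hS.manifold_stratum
  have := hN_symp.manifold
  -- As `P` is immersed in `M`, a continuous map into `P` is smooth once its composite into `M` is;
  -- here that composite is the embedding of `N`.
  have hι : ContMDiff (𝓡 r) (𝓡 p) ∞ (Set.inclusion hN) :=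
    (ContMDiff.iff_comp_isImmersion hS.embedding.isImmersion).2
      ⟨continuous_inclusion hN, hN_symp.embedding.isImmersion.contMDiff⟩
  have hι' := hι.mdifferentiable (by simp)
  have hval := hS.embedding.isImmersion.contMDiff.mdifferentiable (by simp)
  have hproj := hS.submersion.contMDiff.mdifferentiable (by simp)
  calc pullback (d := r) (sliceProjection hN) ΩS
      = pullback (d := r) (stratumProjection x₀ ∘ Set.inclusion hN) ΩS := rfl
    _ = pullback (Set.inclusion hN) (pullback (d := p) (stratumProjection x₀) ΩS) :=
        pullback_comp hproj hι' ΩS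
    _ = pullback (Set.inclusion hN) (pullback (d := p) Subtype.val Ω) := by rw [hS.pullback_eq]
    _ = pullback (d := r) (Subtype.val ∘ Set.inclusion hN) Ω := (pullback_comp hval hι' Ω).symm
    _ = restrictForm (s := r) Ω N := rfl

end Slice

end MomentumSlice


/-! ### Transfer between the slice and the stratum. -/

theorem mainTheorem4 {k m n p : ℕ}
    -- the Lie group `G`
    {G : Type*} [Group G] [TopologicalSpace G] [T2Space G] [SecondCountableTopology G]
    [ChartedSpace (EuclideanSpace ℝ (Fin k)) G] [LieGroup (𝓡 k) ∞ G]
    -- the `2m`-dimensional symplectic manifold `(M, Ω)`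
    {M : Type*} [TopologicalSpace M] [T2Space M] [SecondCountableTopology M]
    [ChartedSpace (EuclideanSpace ℝ (Fin (2 * m))) M] [IsManifold (𝓡 (2 * m)) ∞ M]
    (Ω : TwoForm (2 * m) M) (hΩ : IsSymplecticForm Ω)
    -- the proper Hamiltonian action, with equivariant momentum map `J`
    [MulAction G M] [ContMDiffSMul (𝓡 k) (𝓡 (2 * m)) ∞ G M] [ProperSMul G M]
    (J : M → GroupLieAlgebra (𝓡 k) G →L[ℝ] ℝ) (hJ : IsHamiltonianAction Ω J)
    -- the momentum value `μ`, the base point `x₀ ∈ J_μ`, and the symplectic stratum through `[x₀]`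
    (μ : GroupLieAlgebra (𝓡 k) G →L[ℝ] ℝ) (x₀ : J ⁻¹' {μ})
    [ChartedSpace (EuclideanSpace ℝ (Fin p)) (stratumPreimage x₀)]
    [ChartedSpace (EuclideanSpace ℝ (Fin (2 * n))) (stratum x₀)]
    (ΩS : TwoForm (2 * n) (stratum x₀))
    (hS : IsReducedSymplecticStratum (p := p) Ω x₀ ΩS)
    -- the symplectic submanifold `N` through `x₀`, which `π` maps diffeomorphically onto `US`
    (N : Set M) [ChartedSpace (EuclideanSpace ℝ (Fin (2 * n))) N]
    (hN : N ⊆ stratumPreimage x₀) (hx₀ : (x₀ : M) ∈ N)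
    (hN_symp : IsSymplecticSubmanifold (s := 2 * n) Ω N)
    (US : Set (stratum x₀))
    (hπ : IsDiffeomorphOnto (d := 2 * n) (d' := 2 * n) (sliceProjection hN) US)
    -- the family `H_ε = H₀ + ε H₁` of smooth `G`-invariant Hamiltonians, `|ε| < ε₀`
    (ε₀ : ℝ) (hε₀ : 0 < ε₀) (H₀ : M → ℝ) (H₁ : ℝ → M → ℝ)
    (hH₀ : ContMDiff (𝓡 (2 * m)) 𝓘(ℝ, ℝ) ∞ H₀) (hH₀_inv : ∀ (g : G) x, H₀ (g • x) = H₀ x)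
    (hH₁ : ∀ ε ∈ Set.Ioo (-ε₀) ε₀, ContMDiff (𝓡 (2 * m)) 𝓘(ℝ, ℝ) ∞ (H₁ ε))
    (hH₁_inv : ∀ ε ∈ Set.Ioo (-ε₀) ε₀, ∀ (g : G) x, H₁ ε (g • x) = H₁ ε x)
    -- the intertwining identity
    (hintertwine : ∀ ε ∈ Set.Ioo (-ε₀) ε₀, ∀ f : stratum x₀ → ℝ,
      ContMDiffOn (𝓡 (2 * n)) 𝓘(ℝ, ℝ) ∞ f US → ∀ x : N,
        poissonBracket (restrictForm (s := 2 * n) Ω N) (fun y : N => H₀ y + ε * H₁ ε y)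
            (f ∘ sliceProjection hN) x =
          poissonBracket ΩS (reducedFunction (fun y => H₀ y + ε * H₁ ε y) x₀) f
            (sliceProjection hN x)) :
    -- near-integrability on `N` and on `US` are equivalent
    (IsNearIntegrableOn (restrictForm (s := 2 * n) Ω N) ε₀ (fun y : N => H₀ y) (fun ε (y : N) => H₁ ε y)
        Set.univ ↔
      IsNearIntegrableOn ΩS ε₀ (reducedFunction H₀ x₀) (fun ε => reducedFunction (H₁ ε) x₀) US) ∧
    -- action-angle coordinates for the reduced `H₀` pull back to those for `H₀` on `N`
    (∀ W ⊆ US, ∀ (D : Set (Fin n → ℝ)) (θ : stratum x₀ → Fin n → Circle)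
      (I : stratum x₀ → Fin n → ℝ) (h₀ : (Fin n → ℝ) → ℝ),
      IsActionAngleChartFor ΩS (reducedFunction H₀ x₀) W D θ I h₀ ↔
        IsActionAngleChartFor (restrictForm (s := 2 * n) Ω N) (fun y : N => H₀ y) (sliceProjection hN ⁻¹' W) D
          (θ ∘ sliceProjection hN) (I ∘ sliceProjection hN) h₀) ∧
    -- in corresponding coordinates the near-integrable forms, perturbation included, are the same
    (∀ W ⊆ US, ∀ (D : Set (Fin n → ℝ)) (θ : stratum x₀ → Fin n → Circle)
      (I : stratum x₀ → Fin n → ℝ) (h₀ : (Fin n → ℝ) → ℝ)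
      (h₁ : ℝ → (Fin n → Circle) → (Fin n → ℝ) → ℝ),
      HasNearIntegrableForm ε₀ (reducedFunction H₀ x₀) (fun ε => reducedFunction (H₁ ε) x₀)
          W D θ I h₀ h₁ ↔
        HasNearIntegrableForm ε₀ (fun y : N => H₀ y) (fun ε (y : N) => H₁ ε y)
          (sliceProjection hN ⁻¹' W) D
          (θ ∘ sliceProjection hN) (I ∘ sliceProjection hN) h₀ h₁) ∧
    -- the perturbation terms are related by composition with `π`
    (∀ ε ∈ Set.Ioo (-ε₀) ε₀, ∀ x : N,
      H₁ ε x = reducedFunction (H₁ ε) x₀ (sliceProjection hN x)) := by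
  have hpull := hS.pullback_sliceProjection hN hN_symp
  have hΩS := hS.symplectic.nondegenerate
  have hred : ∀ F : M → ℝ, (∀ (g : G) x, F (g • x) = F x) → ∀ x : N,
      F x = reducedFunction F x₀ (sliceProjection hN x) := fun F hF x =>
    (reducedFunction_stratumProjection hF x₀ ⟨x, hN x.2⟩).symm
  have hred₀ : (fun y : N => H₀ y) = fun y => reducedFunction H₀ x₀ (sliceProjection hN y) :=
    funext (hred H₀ hH₀_inv)
  have hred₁ : ∀ ε ∈ Set.Ioo (-ε₀) ε₀, ∀ x : N,
      H₁ ε x = reducedFunction (H₁ ε) x₀ (sliceProjection hN x) := fun ε hε =>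
    hred (H₁ ε) (hH₁_inv ε hε)
  -- Now the form and `H₀` on `N` are literally pullbacks along `π`. The perturbation is not
  -- rewritten, since its identity is available only for `|ε| < ε₀`; `hred₁` is passed instead.
  rw [← hpull, hred₀]
  exact ⟨hπ.isNearIntegrableOn_iff hΩS hred₁,
    fun W hW D θ I h₀ => (hπ.isActionAngleChartFor_iff ΩS _ hW D θ I h₀).symm,
    fun W hW D θ I h₀ h₁ => (hπ.hasNearIntegrableForm_iff hred₁ hW D θ I h₀ h₁).symm,
    hred₁⟩
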